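/- Let $\mathcal{S}\subset\mathbb{Z}\times\mathbb{Z}$ be a finite set of steps (of arbitrary size) with nonzero weights $w_s\in\mathbb{C}$, and let $S(X,Y)=\sum_{s\in\mathcal{S}}w_sX^{s_x}Y^{s_y}$. Assume that $S$ is not univariate, i.e. both $X$ and $Y$ occur in $S$. Let $\mathbb{K}$ be an algebraic closure of $\mathbb{C}(x,y)$, where $x,y$ are indeterminates. Two pairs $(u,v),(u',v')\in\mathbb{K}\times\mathbb{K}$ are adjacent if $S(u,v)=S(u',v')$ (both values being defined) and $u=u'$ or $v=v'$. The orbit $\mathcal{O}$ is the set of pairs related to $(x,y)$ by the transitive closure of adjacency. Let $k=\mathbb{C}(S(x,y))$ and let $k(\mathcal{O})\subset\mathbb{K}$ be generated over $k$ by all coordinates of pairs of $\mathcal{O}$. Put $G_x=\operatorname{Aut}(k(\mathcal{O})|k(x))$ and $G_y=\operatorname{Aut}(k(\mathcal{O})|k(y))$, and let $G=\langle G_x,G_y\rangle$ be the subgroup they generate in $\operatorname{Aut}(k(\mathcal{O})|k)$. Let $\widetilde K(X,Y,t)=X^aY^b(1-tS(X,Y))$, where $a,b\ge 0$ are the least integers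 that make this a polynomial. A fraction of $\mathbb{C}(X,Y,t)$ is regular if $\widetilde K$ does not divide its reduced denominator. A pair of Galois invariants is a pair of regular fractions $I\in\mathbb{C}(X,t)$, $J\in\mathbb{C}(Y,t)$ with $I(x,1/S(x,y))=J(y,1/S(x,y))$; it is constant if $I=J=F$ for some $F\in\mathbb{C}(t)$. Then the following statements are equivalent: 1. the orbit $\mathcal{O}$ is finite; 2. the group $G$ is finite; 3. there exists a pair of non-constant Galois invariants; 4. $k\subsetneq k(x)\cap k(y)$. -/

import Mathlib

noncomputable section

namespace QuadrantWalk

/-- A weighted model of walks: a finite set of steps in `ℤ × ℤ`, of arbitrary size, and a nonzero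
complex weight attached to each step (the values of `weight` outside `steps` are never used). -/
structure WeightedModel where
  steps : Finset (ℤ × ℤ)
  weight : ℤ × ℤ → ℂ
  weight_ne_zero : ∀ s ∈ steps, weight s ≠ 0

/-- The field `ℂ(x, y)` of rational fractions in two indeterminates. -/
abbrev Cxy : Type := FractionRing (MvPolynomial (Fin 2) ℂ)

/-- The field `𝕂`, an algebraic closure of `ℂ(x, y)`. -/
abbrev KK : Type := AlgebraicClosure Cxy

/-- The indeterminate `x`, as an element of `𝕂`. -/
def x : KK := algebraMap Cxy KK (algebraMap (MvPolynomial (Fin 2) ℂ) Cxy (MvPolynomial.X 0))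

/-- The indeterminate `y`, as an element of `𝕂`. -/
def y : KK := algebraMap Cxy KK (algebraMap (MvPolynomial (Fin 2) ℂ) Cxy (MvPolynomial.X 1))

theorem x_ne_zero : x ≠ 0 := by
  simp [x]

theorem y_ne_zero : y ≠ 0 := by
  simp [y]

namespace WeightedModel

variable (W : WeightedModel)

/-- The step polynomial `S` is not univariate: both variables occur in it. (No cancellation can
happen, since distinct steps give distinct monomials, with nonzero coefficients.) -/
def NonUnivariate : Prop :=
  (∃ s ∈ W.steps, s.1 ≠ 0) ∧ (∃ s ∈ W.steps, s.2 ≠ 0)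

/-- The Laurent polynomial `S` can be evaluated at `(u, v)`: no zero coordinate is raised to a
negative power. -/
def DefinedAt (u v : KK) : Prop :=
  ∀ s ∈ W.steps, (u = 0 → 0 ≤ s.1) ∧ (v = 0 → 0 ≤ s.2)

/-- The value `S(u, v)` of the Laurent polynomial of the model. -/
def S (u v : KK) : KK :=
  ∑ s ∈ W.steps, algebraMap ℂ KK (W.weight s) * u ^ s.1 * v ^ s.2

/-! ### The orbit -/

/-- The values `S(p)` and `S(q)` both exist and are equal. -/
def SameValue (p q : KK × KK) : Prop :=
  W.DefinedAt p.1 p.2 ∧ W.DefinedAt q.1 q.2 ∧ W.S p.1 p.2 = W.S q.1 q.2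

/-- `x`-adjacency: same value of `S` and same first coordinate. -/
def XAdjacent (p q : KK × KK) : Prop := W.SameValue p q ∧ p.1 = q.1

/-- `y`-adjacency: same value of `S` and same second coordinate. -/
def YAdjacent (p q : KK × KK) : Prop := W.SameValue p q ∧ p.2 = q.2

/-- Adjacency of pairs. -/
def Adjacent (p q : KK × KK) : Prop := W.XAdjacent p q ∨ W.YAdjacent p q

/-- The orbit of the walk: all pairs related to `(x, y)` by the transitive closure of adjacency. -/
def orbit : Set (KK × KK) := {p | Relation.TransGen W.Adjacent p (x, y)}

theorem xy_mem_orbit : (x, y) ∈ W.orbit := by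
  have h : W.DefinedAt x y := fun s _ =>
    ⟨fun h => absurd h x_ne_zero, fun h => absurd h y_ne_zero⟩
  exact Relation.TransGen.single (Or.inl ⟨⟨h, h, rfl⟩, rfl⟩)

/-! ### The fields and the group -/

/-- The field `k = ℂ(S(x, y))`. -/
def k : IntermediateField ℂ KK := IntermediateField.adjoin ℂ {W.S x y}

/-- The field `k(x)`. -/
def kx : IntermediateField W.k KK := IntermediateField.adjoin W.k {x}

/-- The field `k(y)`. -/
def ky : IntermediateField W.k KK := IntermediateField.adjoin W.k {y}

/-- The field `k(𝒪)`, generated over `k` by the coordinates of the pairs of the orbit. -/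
def kO : IntermediateField W.k KK :=
  IntermediateField.adjoin W.k (Prod.fst '' W.orbit ∪ Prod.snd '' W.orbit)

theorem kx_le_kO : W.kx ≤ W.kO := by
  refine IntermediateField.adjoin.mono _ _ _ ?_
  rintro _ rfl
  exact Or.inl ⟨(x, y), W.xy_mem_orbit, rfl⟩

theorem ky_le_kO : W.ky ≤ W.kO := by
  refine IntermediateField.adjoin.mono _ _ _ ?_
  rintro _ rfl
  exact Or.inr ⟨(x, y), W.xy_mem_orbit, rfl⟩

/-- The group `G_x = Aut(k(𝒪) | k(x))`, inside the group of `k`-automorphisms of `k(𝒪)`. -/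
def Gx : Subgroup (W.kO ≃ₐ[W.k] W.kO) :=
  (IntermediateField.restrict W.kx_le_kO).fixingSubgroup

/-- The group `G_y = Aut(k(𝒪) | k(y))`, inside the group of `k`-automorphisms of `k(𝒪)`. -/
def Gy : Subgroup (W.kO ≃ₐ[W.k] W.kO) :=
  (IntermediateField.restrict W.ky_le_kO).fixingSubgroup

/-- The group of the walk `G = ⟨G_x, G_y⟩`. -/
def G : Subgroup (W.kO ≃ₐ[W.k] W.kO) := W.Gx ⊔ W.Gy

end WeightedModel

/-! ### Rational fractions in `X, Y, t` and Galois invariants -/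

/-- The polynomial ring `ℂ[X, Y, t]`; the variables `0, 1, 2` are `X, Y, t`. -/
abbrev PolyXYt : Type := MvPolynomial (Fin 3) ℂ

/-- The field `ℂ(X, Y, t)`. -/
abbrev FracXYt : Type := FractionRing PolyXYt

/-- The variable `X`, `Y` or `t` (for `i = 0, 1, 2`) as a rational fraction. -/
def fracVar (i : Fin 3) : FracXYt := algebraMap PolyXYt FracXYt (MvPolynomial.X i)

/-- The subfield `ℂ(X, t)` of `ℂ(X, Y, t)`. -/
def fracXt : IntermediateField ℂ FracXYt := IntermediateField.adjoin ℂ {fracVar 0, fracVar 2}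

/-- The subfield `ℂ(Y, t)` of `ℂ(X, Y, t)`. -/
def fracYt : IntermediateField ℂ FracXYt := IntermediateField.adjoin ℂ {fracVar 1, fracVar 2}

/-- The subfield `ℂ(t)` of `ℂ(X, Y, t)`. -/
def fract : IntermediateField ℂ FracXYt := IntermediateField.adjoin ℂ {fracVar 2}

namespace WeightedModel

variable (W : WeightedModel)

/-- The least `a : ℕ` such that `X ^ a * S(X, Y)` has no negative power of `X`. -/
def shiftX : ℕ := W.steps.sup fun s => (-s.1).toNat

/-- The least `b : ℕ` such that `Y ^ b * S(X, Y)` has no negative power of `Y`. -/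
def shiftY : ℕ := W.steps.sup fun s => (-s.2).toNat

/-- The kernel polynomial `X ^ a * Y ^ b * (1 - t * S(X, Y))`, with `a = shiftX` and `b = shiftY`.
The truncations to `ℕ` are harmless: `0 ≤ a + s.1` and `0 ≤ b + s.2` for each step `s`. -/
def kernelPoly : PolyXYt :=
  MvPolynomial.X 0 ^ W.shiftX * MvPolynomial.X 1 ^ W.shiftY -
    MvPolynomial.X 2 * ∑ s ∈ W.steps, MvPolynomial.C (W.weight s) *
      MvPolynomial.X 0 ^ ((W.shiftX : ℤ) + s.1).toNat *
      MvPolynomial.X 1 ^ ((W.shiftY : ℤ) + s.2).toNat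

/-- A fraction is regular if the kernel polynomial does not divide its (reduced) denominator. -/
def IsRegular (H : FracXYt) : Prop :=
  ¬ W.kernelPoly ∣ (IsFractionRing.den PolyXYt H : PolyXYt)

/-- The evaluation `H(x, y, 1 / S(x, y))` of a regular fraction `H`. -/
def evalXY (H : FracXYt) : KK :=
  MvPolynomial.aeval ![x, y, 1 / W.S x y] (IsFractionRing.num PolyXYt H) /
    MvPolynomial.aeval ![x, y, 1 / W.S x y] (IsFractionRing.den PolyXYt H : PolyXYt)

/-- Galois equivalence of two regular fractions. -/
def GaloisEquivalent (H₁ H₂ : FracXYt) : Prop :=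
  W.IsRegular H₁ ∧ W.IsRegular H₂ ∧ W.evalXY H₁ = W.evalXY H₂

/-- `(I, J)` is a pair of Galois invariants: `I ∈ ℂ(X, t)` and `J ∈ ℂ(Y, t)` are regular fractions
that are Galois equivalent. -/
def IsGaloisInvariantPair (I J : FracXYt) : Prop :=
  I ∈ fracXt ∧ J ∈ fracYt ∧ W.GaloisEquivalent I J

end WeightedModel

/-- A constant pair is a pair `(F(t), F(t))` with `F ∈ ℂ(t)`. -/
def IsConstantPair (I J : FracXYt) : Prop := ∃ F ∈ fract, I = F ∧ J = F

end QuadrantWalk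

end

/-! Since S is not univariate, S(x,y) is algebraically independent of x and of y, and 𝕂 is algebraic
over k(x) and over k(y). The rest is Galois theory in 𝕂.

An element of G_x or G_y extends to 𝕂, preserves adjacency and sends (x,y) to an adjacent pair. So G
permutes the orbit, faithfully since the coordinates generate k(𝒪): a finite orbit gives a finite G
(`finite_G_of_orbit_finite`).

As k(𝒪) is stable under Aut(𝕂|k(x)) and Aut(𝕂|k(y)), elements fixed by G lie in L = k(x) ∩ k(y)
(`mem_inf_of_fixed`). If G were finite and L = k, then k(𝒪) would be algebraic over k, but x is
transcendental over k.

Every orbit pair is the image of (x,y) under an automorphism of 𝕂 fixing L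
(`exists_algEquiv_of_mem_orbit`). An f in L outside k is a nonconstant fraction over k in x, and
also in y, so x and y are algebraic over L and have finitely many images.

Evaluation at (x, y, 1/S(x,y)) identifies ℂ(X,t), ℂ(Y,t), ℂ(t) with k(x), k(y), k; nonconstant pairs
of invariants thus correspond to elements of L outside k. -/

noncomputable section
open IntermediateField algebraAdjoinAdjoin

/-! ### Algebraically independent pairs and relative algebraic closure -/

section AlgebraicIndependence

variable {F K : Type*} [Field F] [Field K] [Algebra F K]

theorem transcendental_intermediateField_adjoin_iff {s : Set K} {a : K} :
    Transcendental (IntermediateField.adjoin F s) a ↔ Transcendental (Algebra.adjoin F s) a :=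
  not_congr (IsFractionRing.isAlgebraic_iff (Algebra.adjoin F s)
    (IntermediateField.adjoin F s) K).symm

theorem algebraicIndependent_pair_iff {a u : K} :
    AlgebraicIndependent F ![a, u] ↔ Transcendental F u ∧ Transcendental F⟮u⟯ a := by
  have h : ![a, u] = (fun o : Option (Fin 1) ↦ o.elim a ![u]) ∘ finSuccEquiv 1 := by
    ext i
    fin_cases i <;> rfl
  rw [h, algebraicIndependent_equiv, AlgebraicIndependent.option_iff,
    algebraicIndependent_iff_transcendental, transcendental_intermediateField_adjoin_iff,
    Matrix.range_cons, Matrix.range_empty, Set.union_empty]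

theorem AlgebraicIndependent.pair_swap {a u : K} (h : AlgebraicIndependent F ![a, u]) :
    AlgebraicIndependent F ![u, a] := by
  have := h.comp (Equiv.swap (0 : Fin 2) 1) (Equiv.injective _)
  convert this using 1
  ext i
  fin_cases i <;> rfl

/-- The elements algebraic over an intermediate field, as an intermediate field over the base. -/
def IntermediateField.algClosure (E : IntermediateField F K) : IntermediateField F K :=
  (algebraicClosure E K).restrictScalars F

theorem IntermediateField.mem_algClosure {E : IntermediateField F K} {a : K} :
    a ∈ E.algClosure ↔ IsAlgebraic E a :=
  mem_algebraicClosure_iff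

theorem IntermediateField.le_algClosure (E : IntermediateField F K) : E ≤ E.algClosure :=
  fun a ha ↦ mem_algClosure.2 (isAlgebraic_algebraMap (⟨a, ha⟩ : E))

theorem IntermediateField.isAlgebraic_of_isAlgebraic_algClosure {E : IntermediateField F K} {a : K}
    (h : IsAlgebraic E.algClosure a) : IsAlgebraic E a :=
  have h' : IsAlgebraic (algebraicClosure E K) a := h
  IsAlgebraic.restrictScalars E h'

end AlgebraicIndependence

namespace QuadrantWalk

theorem algebraicIndependent_xy : AlgebraicIndependent ℂ ![x, y] := by
  have h : AlgebraicIndependent ℂ (MvPolynomial.X : Fin 2 → MvPolynomial (Fin 2) ℂ) :=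
    MvPolynomial.algebraicIndependent_X _ _
  have h2 := h.map' (f := IsScalarTower.toAlgHom ℂ (MvPolynomial (Fin 2) ℂ) KK) (by
    rw [IsScalarTower.coe_toAlgHom', IsScalarTower.algebraMap_eq _ Cxy KK]
    exact (FaithfulSMul.algebraMap_injective Cxy KK).comp (IsFractionRing.injective _ _))
  convert h2 using 1
  ext i
  fin_cases i <;> simp [x, y, IsScalarTower.algebraMap_apply (MvPolynomial (Fin 2) ℂ) Cxy KK]

theorem isAlgebraic_of_mem (F : IntermediateField ℂ KK) (hx : x ∈ F) (hy : y ∈ F) :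
    Algebra.IsAlgebraic F KK := by
  have hP : ∀ p : MvPolynomial (Fin 2) ℂ, algebraMap Cxy KK (algebraMap _ Cxy p) ∈ F := by
    intro p
    induction p using MvPolynomial.induction_on with
    | C a =>
      have : algebraMap Cxy KK (algebraMap (MvPolynomial (Fin 2) ℂ) Cxy (MvPolynomial.C a)) = algebraMap ℂ KK a := by
        rw [← MvPolynomial.algebraMap_eq, ← IsScalarTower.algebraMap_apply,
          ← IsScalarTower.algebraMap_apply]
      rw [this]
      exact F.algebraMap_mem a
    | add p q hp hq => simpa only [map_add] using F.add_mem hp hq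
    | mul_X p i hp =>
      rw [map_mul, map_mul]
      refine F.mul_mem hp ?_
      fin_cases i
      exacts [hx, hy]
  have hF : ∀ c : Cxy, algebraMap Cxy KK c ∈ F := by
    intro c
    obtain ⟨p, q, -, rfl⟩ := IsFractionRing.div_surjective (A := MvPolynomial (Fin 2) ℂ) c
    rw [map_div₀]
    exact F.div_mem (hP p) (hP q)
  let i : Cxy →+* F := (algebraMap Cxy KK).codRestrict F.toSubring hF
  let := i.toAlgebra
  have : IsScalarTower Cxy F KK := IsScalarTower.of_algebraMap_eq fun _ ↦ rfl
  exact Algebra.IsAlgebraic.tower_top (K := Cxy) F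

end QuadrantWalk

/-! ### Transcendence properties of the values of S -/

namespace QuadrantWalk
namespace WeightedModel

variable (W : WeightedModel)

/-- The model obtained by exchanging the two coordinates. -/
def swap : WeightedModel where
  steps := W.steps.map (Equiv.prodComm ℤ ℤ).toEmbedding
  weight s := W.weight s.swap
  weight_ne_zero s hs := by
    obtain ⟨t, ht, rfl⟩ := Finset.mem_map.1 hs
    exact W.weight_ne_zero t ht

theorem swap_S (u v : KK) : W.swap.S u v = W.S v u := by
  simp only [S, swap, Finset.sum_map]
  exact Finset.sum_congr rfl fun s _ ↦ mul_right_comm _ _ _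

theorem swap_exists (h : ∃ s ∈ W.steps, s.1 ≠ 0) : ∃ s ∈ W.swap.steps, s.2 ≠ 0 := by
  obtain ⟨s, hs, h0⟩ := h
  exact ⟨s.swap, Finset.mem_map_of_mem _ hs, h0⟩

variable {W}

theorem S_mem {F : IntermediateField ℂ KK} {u v : KK} (hu : u ∈ F) (hv : v ∈ F) : W.S u v ∈ F :=
  sum_mem fun _ _ ↦ mul_mem (mul_mem (F.algebraMap_mem _) (zpow_mem hu _)) (zpow_mem hv _)

theorem map_S (σ : KK →ₐ[ℂ] KK) (u v : KK) : σ (W.S u v) = W.S (σ u) (σ v) := by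
  simp [S, map_sum, map_mul, map_zpow₀, AlgHom.commutes]

theorem sum_zpow_ne_zero {T : Finset ℤ} {c : ℤ → ℂ} (hT : T.Nonempty) (hc : ∀ i ∈ T, c i ≠ 0)
    {u : KK} (hu : Transcendental ℂ u) : ∑ i ∈ T, algebraMap ℂ KK (c i) * u ^ i ≠ 0 := by
  have hu0 : u ≠ 0 := fun h ↦ hu (h ▸ isAlgebraic_zero)
  obtain ⟨n, hn⟩ : ∃ n : ℕ, ∀ i ∈ T, 0 ≤ i + n :=
    ⟨T.sup fun i ↦ (-i).toNat, fun i hi ↦ by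
      have := Finset.le_sup (f := fun i : ℤ ↦ (-i).toNat) hi
      omega⟩
  intro h
  obtain ⟨i₀, hi₀⟩ := hT
  let p : Polynomial ℂ := ∑ i ∈ T, Polynomial.C (c i) * Polynomial.X ^ (i + n).toNat
  have hp : Polynomial.aeval u p = 0 := by
    have : Polynomial.aeval u p = (∑ i ∈ T, algebraMap ℂ KK (c i) * u ^ i) * u ^ n := by
      simp only [p, map_sum, map_mul, Polynomial.aeval_C, map_pow, Polynomial.aeval_X,
        Finset.sum_mul]
      refine Finset.sum_congr rfl fun i hi ↦ ?_
      rw [← zpow_natCast, Int.toNat_of_nonneg (hn i hi), zpow_add₀ hu0, zpow_natCast, mul_assoc]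
    rw [this, h, zero_mul]
  have h0 : p = 0 := by
    by_contra h0
    exact hu ⟨p, h0, hp⟩
  have hcoeff : p.coeff (i₀ + n).toNat = c i₀ := by
    simp only [p, Polynomial.finsetSum_coeff, Polynomial.coeff_C_mul, Polynomial.coeff_X_pow]
    rw [Finset.sum_eq_single i₀]
    · simp
    · intro i hi hne
      have := hn i hi
      have := hn i₀ hi₀
      rw [if_neg (by omega), mul_zero]
    · exact fun h ↦ absurd hi₀ h
  rw [h0, Polynomial.coeff_zero] at hcoeff
  exact hc i₀ hi₀ hcoeff.symm

/-- Once denominators in Y are cleared, v is a root of S(u,Y) - S(u,v). This is not the zero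
polynomial: the coefficient at a step with nonzero second coordinate is a nonzero Laurent polynomial
in the transcendental u. -/
theorem isAlgebraic_of_S_mem (hW : ∃ s ∈ W.steps, s.2 ≠ 0) {F : IntermediateField ℂ KK} {u v : KK}
    (hu : Transcendental ℂ u) (huF : u ∈ F) (hS : W.S u v ∈ F) : IsAlgebraic F v := by
  obtain ⟨s₀, hs₀, hj₀⟩ := hW
  by_cases hv : v = 0
  · exact hv ▸ isAlgebraic_zero
  have hn : ∀ s ∈ W.steps, 0 ≤ s.2 + (W.shiftY : ℤ) := fun s hs ↦ by
    have := Finset.le_sup (f := fun s : ℤ × ℤ ↦ (-s.2).toNat) hs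
    simp only [shiftY]
    omega
  let U : F := ⟨u, huF⟩
  let p : Polynomial F := ∑ s ∈ W.steps, Polynomial.C (algebraMap ℂ F (W.weight s) * U ^ s.1) *
    Polynomial.X ^ (s.2 + W.shiftY).toNat - Polynomial.C ⟨W.S u v, hS⟩ * Polynomial.X ^ W.shiftY
  have hp : Polynomial.aeval v p = 0 := by
    simp only [p, map_sub, map_sum, map_mul, Polynomial.aeval_C, map_pow, Polynomial.aeval_X]
    rw [sub_eq_zero]
    change _ = W.S u v * _
    rw [S, Finset.sum_mul]
    refine Finset.sum_congr rfl fun s hs ↦ ?_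
    rw [← zpow_natCast, Int.toNat_of_nonneg (hn s hs), zpow_add₀ hv, zpow_natCast, ← mul_assoc,
      map_zpow₀, ← IsScalarTower.algebraMap_apply]
    rfl
  refine ⟨p, fun h0 ↦ ?_, hp⟩
  have hcoeff : algebraMap F KK (p.coeff (s₀.2 + W.shiftY).toNat) =
      ∑ i ∈ (W.steps.filter fun s ↦ s.2 = s₀.2).image Prod.fst,
        algebraMap ℂ KK (W.weight (i, s₀.2)) * u ^ i := by
    have := hn s₀ hs₀
    rw [Finset.sum_image, Finset.sum_filter]
    · simp only [p, Polynomial.coeff_sub, Polynomial.finsetSum_coeff, Polynomial.coeff_C_mul,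
        Polynomial.coeff_X_pow]
      -- As `s₀.2 ≠ 0`, this degree differs from `shiftY`, the only one to which S(u,v) contributes.
      rw [if_neg (by omega : ¬ (s₀.2 + (W.shiftY : ℤ)).toNat = W.shiftY), mul_zero, sub_zero,
        map_sum]
      refine Finset.sum_congr rfl fun s hs ↦ ?_
      have := hn s hs
      by_cases h : s.2 = s₀.2
      · rw [if_pos (by omega), if_pos h, mul_one, map_mul, map_zpow₀,
          ← IsScalarTower.algebraMap_apply, ← h]
        rfl
      · rw [if_neg (by omega), if_neg h, mul_zero, map_zero]
    · intro s hs t ht hst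
      simp only [Finset.coe_filter, Set.mem_ofPred_eq] at hs ht
      exact Prod.ext hst (hs.2.trans ht.2.symm)
  rw [h0, Polynomial.coeff_zero, map_zero] at hcoeff
  refine sum_zpow_ne_zero ?_ ?_ hu hcoeff.symm
  · exact ⟨s₀.1, Finset.mem_image.2 ⟨s₀, by simpa using hs₀, rfl⟩⟩
  · intro i hi
    obtain ⟨s, hs, rfl⟩ := Finset.mem_image.1 hi
    rw [Finset.mem_filter] at hs
    rw [← hs.2]
    exact W.weight_ne_zero s hs.1

theorem transcendental_S (hW : ∃ s ∈ W.steps, s.2 ≠ 0) {u v : KK}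
    (h : AlgebraicIndependent ℂ ![v, u]) : Transcendental ℂ⟮u⟯ (W.S u v) := by
  obtain ⟨hu, hv⟩ := algebraicIndependent_pair_iff.1 h
  intro hS
  exact hv (isAlgebraic_of_isAlgebraic_algClosure (isAlgebraic_of_S_mem hW hu
    (le_algClosure _ (mem_adjoin_simple_self ℂ u)) (mem_algClosure.2 hS)))

theorem transcendental_of_S_eq (hW : ∃ s ∈ W.steps, s.2 ≠ 0) {u v v' : KK}
    (h : AlgebraicIndependent ℂ ![v, u]) (hS : W.S u v' = W.S u v) : Transcendental ℂ⟮u⟯ v' := by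
  intro hv'
  refine transcendental_S hW h (hS ▸ mem_algClosure.1 (S_mem ?_ (mem_algClosure.2 hv')))
  exact le_algClosure _ (mem_adjoin_simple_self ℂ u)

theorem isAlgebraic_adjoin_S (hW : ∃ s ∈ W.steps, s.2 ≠ 0) {u v : KK} (hu : Transcendental ℂ u)
    (hK : ∀ F : IntermediateField ℂ KK, u ∈ F → v ∈ F → Algebra.IsAlgebraic F KK)
    {F : IntermediateField ℂ KK} (huF : u ∈ F) (hS : W.S u v ∈ F) : Algebra.IsAlgebraic F KK where
  isAlgebraic z := by
    have := hK F.algClosure (le_algClosure _ huF)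
      (mem_algClosure.2 (isAlgebraic_of_S_mem hW hu huF hS))
    exact isAlgebraic_of_isAlgebraic_algClosure (Algebra.IsAlgebraic.isAlgebraic z)

/-! ### Automorphisms of 𝕂 reaching the orbit, and finiteness of the orbit -/

/-- Both v and v' are transcendental over ℂ(u), so v ↦ v' defines an isomorphism ℂ(u)(v) ≅ ℂ(u)(v'),
which extends to 𝕂. The assumption `hK` is symmetric in u and v, so the lemma serves (x,y) and, for
the swapped model, (y,x). -/
theorem exists_algEquiv_of_S_eq (hW : ∃ s ∈ W.steps, s.2 ≠ 0) {u v v' : KK}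
    (h : AlgebraicIndependent ℂ ![v, u])
    (hK : ∀ F : IntermediateField ℂ KK, u ∈ F → v ∈ F → Algebra.IsAlgebraic F KK)
    (hS : W.S u v' = W.S u v) : ∃ σ : KK ≃ₐ[ℂ] KK, σ u = u ∧ σ v = v' := by
  obtain ⟨hu, hv⟩ := algebraicIndependent_pair_iff.1 h
  have hv' := transcendental_of_S_eq hW h hS
  let e : ℂ⟮u⟯⟮v⟯ ≃ₐ[ℂ⟮u⟯] ℂ⟮u⟯⟮v'⟯ :=
    (RatFunc.algEquivOfTranscendental v hv).symm.trans (RatFunc.algEquivOfTranscendental v' hv')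
  have he : e (AdjoinSimple.gen ℂ⟮u⟯ v) = AdjoinSimple.gen ℂ⟮u⟯ v' :=
    Subtype.ext (by simp [e, RatFunc.algEquivOfTranscendental_X])
  have hu' : u ∈ (ℂ⟮u⟯⟮v⟯).restrictScalars ℂ :=
    ℂ⟮u⟯⟮v⟯.algebraMap_mem ⟨u, mem_adjoin_simple_self ℂ u⟩
  have halg : Algebra.IsAlgebraic ℂ⟮u⟯⟮v⟯ KK :=
    hK ((ℂ⟮u⟯⟮v⟯).restrictScalars ℂ) hu' (mem_adjoin_simple_self ℂ⟮u⟯ v)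
  obtain ⟨φ, hφ⟩ := IntermediateField.exists_algHom_of_splits' (E := KK)
    ((ℂ⟮u⟯⟮v'⟯).val.comp e.toAlgHom)
    fun s ↦ ⟨(Algebra.IsAlgebraic.isAlgebraic s).isIntegral, IsAlgClosed.splits _⟩
  have hφu : φ u = u := φ.commutes ⟨u, mem_adjoin_simple_self ℂ u⟩
  have hφv : φ v = v' := by
    have := DFunLike.congr_fun hφ (AdjoinSimple.gen ℂ⟮u⟯ v)
    simpa [AlgHom.domRestrict, he] using this
  let ψ : KK →ₐ[ℂ] KK := φ.restrictScalars ℂ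
  -- Surjectivity: the extension fixes u and S(u,v), and an endomorphism of 𝕂 over a field over
  -- which 𝕂 is algebraic is bijective.
  let F : IntermediateField ℂ KK := IntermediateField.adjoin ℂ {u, W.S u v}
  have hF : Algebra.IsAlgebraic F KK := isAlgebraic_adjoin_S hW hu hK
    (subset_adjoin ℂ _ (by simp)) (subset_adjoin ℂ _ (by simp))
  have hψ : ψ.comp F.val = F.val := by
    refine algHom_ext_of_eq_adjoin ℂ rfl ?_
    rintro z (rfl | rfl)
    · exact hφu
    · change ψ (W.S _ v) = W.S _ v
      rw [map_S]
      change W.S (φ _) (φ v) = _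
      rw [hφu, hφv, hS]
  let χ : KK →ₐ[F] KK := { ψ with commutes' := fun r ↦ DFunLike.congr_fun hψ r }
  exact ⟨AlgEquiv.ofBijective ψ (Algebra.IsAlgebraic.algHom_bijective χ), hφu, hφv⟩

theorem mem_kx_iff {z : KK} : z ∈ W.kx ↔ z ∈ IntermediateField.adjoin ℂ {W.S x y, x} := by
  rw [← Set.singleton_union, ← adjoin_adjoin_left]
  rfl

theorem mem_ky_iff {z : KK} : z ∈ W.ky ↔ z ∈ IntermediateField.adjoin ℂ {W.S x y, y} := by
  rw [← Set.singleton_union, ← adjoin_adjoin_left]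
  rfl

theorem algHom_apply_of_mem_adjoin {σ : KK →ₐ[ℂ] KK} {s : Set KK} (h : ∀ a ∈ s, σ a = a) {z : KK}
    (hz : z ∈ IntermediateField.adjoin ℂ s) : σ z = z := by
  have : σ.comp (IntermediateField.adjoin ℂ s).val = (IntermediateField.adjoin ℂ s).val :=
    algHom_ext_of_eq_adjoin ℂ rfl fun a ha ↦ h a ha
  exact DFunLike.congr_fun this ⟨z, hz⟩

theorem isAlgebraic_kx (hW : W.NonUnivariate) : Algebra.IsAlgebraic W.kx KK := by
  refine isAlgebraic_adjoin_S (F := W.kx.restrictScalars ℂ) hW.2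
    (algebraicIndependent_xy.transcendental 0) (fun F ↦ isAlgebraic_of_mem F) ?_ ?_
  · exact mem_kx_iff.2 (subset_adjoin ℂ _ (by simp))
  · exact mem_kx_iff.2 (subset_adjoin ℂ _ (by simp))

theorem isAlgebraic_ky (hW : W.NonUnivariate) : Algebra.IsAlgebraic W.ky KK := by
  refine isAlgebraic_adjoin_S (W := W.swap) (F := W.ky.restrictScalars ℂ) (swap_exists W hW.1)
    (algebraicIndependent_xy.transcendental 1)
    (v := x) (fun F hy hx ↦ isAlgebraic_of_mem F hx hy) ?_ ?_
  · exact mem_ky_iff.2 (subset_adjoin ℂ _ (by simp))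
  · rw [swap_S]
    exact mem_ky_iff.2 (subset_adjoin ℂ _ (by simp))

theorem exists_algEquiv_fixing_kx (hW : W.NonUnivariate) {v : KK} (h : W.S x v = W.S x y) :
    ∃ σ : KK ≃ₐ[ℂ] KK, σ x = x ∧ σ y = v ∧ ∀ z ∈ W.kx, σ z = z := by
  obtain ⟨σ, hx, hy⟩ := exists_algEquiv_of_S_eq hW.2 algebraicIndependent_xy.pair_swap
    (fun F ↦ isAlgebraic_of_mem F) h
  refine ⟨σ, hx, hy, fun z hz ↦
    algHom_apply_of_mem_adjoin (σ := σ.toAlgHom) ?_ (mem_kx_iff.1 hz)⟩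
  rintro a (rfl | rfl)
  · rw [map_S]
    change W.S (σ x) (σ y) = _
    rw [hx, hy, h]
  · exact hx

theorem exists_algEquiv_fixing_ky (hW : W.NonUnivariate) {u : KK} (h : W.S u y = W.S x y) :
    ∃ σ : KK ≃ₐ[ℂ] KK, σ x = u ∧ σ y = y ∧ ∀ z ∈ W.ky, σ z = z := by
  obtain ⟨σ, hy, hx⟩ := exists_algEquiv_of_S_eq (W := W.swap) (swap_exists W hW.1)
    algebraicIndependent_xy (v' := u) (fun F hy hx ↦ isAlgebraic_of_mem F hx hy)
    (by rw [swap_S, swap_S, h])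
  refine ⟨σ, hx, hy, fun z hz ↦
    algHom_apply_of_mem_adjoin (σ := σ.toAlgHom) ?_ (mem_ky_iff.1 hz)⟩
  rintro a (rfl | rfl)
  · rw [map_S]
    change W.S (σ x) (σ y) = _
    rw [hx, hy, h]
  · exact hy

/-- Induction along the path to (x,y). If σ carries (x,y) to q and p is adjacent to q, then σ⁻¹(p)
shares a coordinate and the value of S with (x,y), hence is τ(x,y) with τ fixing k(x) or k(y); then
σ ∘ τ carries (x,y) to p. -/
theorem exists_algEquiv_of_mem_orbit (hW : W.NonUnivariate) {p : KK × KK} (hp : p ∈ W.orbit) :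
    ∃ σ : KK ≃ₐ[ℂ] KK, σ x = p.1 ∧ σ y = p.2 ∧ ∀ z ∈ W.kx ⊓ W.ky, σ z = z := by
  induction (show Relation.ReflTransGen W.Adjacent p (x, y) from
    Relation.TransGen.to_reflTransGen hp) using Relation.ReflTransGen.head_induction_on with
  | refl => exact ⟨AlgEquiv.refl, rfl, rfl, fun _ _ ↦ rfl⟩
  | @head p q hpq hq ih =>
    obtain ⟨σ, hx, hy, hσ⟩ := ih (by
      rcases Relation.reflTransGen_iff_eq_or_transGen.1 hq with h | h
      · exact h ▸ W.xy_mem_orbit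
      · exact h)
    have key : W.S (σ.symm p.1) (σ.symm p.2) = W.S x y := by
      have hS : W.S p.1 p.2 = W.S q.1 q.2 := hpq.elim (·.1.2.2) (·.1.2.2)
      have h1 := map_S (W := W) σ.symm.toAlgHom p.1 p.2
      rw [hS, ← hx, ← hy] at h1
      have h2 := map_S (W := W) σ.symm.toAlgHom (σ x) (σ y)
      rw [h1] at h2
      simpa using h2
    rcases hpq with h | h
    · have hx' : σ.symm p.1 = x := by rw [h.2, ← hx, AlgEquiv.symm_apply_apply]
      rw [hx'] at key
      obtain ⟨τ, h1, h2, h3⟩ := exists_algEquiv_fixing_kx hW key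
      refine ⟨τ.trans σ, ?_, ?_, fun z hz ↦ ?_⟩
      · simp [h1, hx, h.2]
      · simp [h2]
      · simp [h3 z hz.1, hσ z hz]
    · have hy' : σ.symm p.2 = y := by rw [h.2, ← hy, AlgEquiv.symm_apply_apply]
      rw [hy'] at key
      obtain ⟨τ, h1, h2, h3⟩ := exists_algEquiv_fixing_ky hW key
      refine ⟨τ.trans σ, ?_, ?_, fun z hz ↦ ?_⟩
      · simp [h1]
      · simp [h2, hy, h.2]
      · simp [h3 z hz.2, hσ z hz]

/-- A generator of a simple extension `k(a)` is algebraic over any subextension strictly larger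
than `k`. -/
theorem isAlgebraic_of_mem_adjoin_simple {k K : Type*} [Field k] [Field K] [Algebra k K] {a f : K}
    (hf : f ∈ k⟮a⟯) (hfk : f ∉ (⊥ : IntermediateField k K)) {L : IntermediateField k K}
    (hL : f ∈ L) : IsAlgebraic L a := by
  obtain ⟨p, q, rfl⟩ := (mem_adjoin_simple_iff k f).1 hf
  set f := Polynomial.aeval a p / Polynomial.aeval a q with hfdef
  have hq : Polynomial.aeval a q ≠ 0 := fun h ↦ hfk (by rw [hfdef, h, div_zero]; exact zero_mem _)
  -- With f = p(a)/q(a), the generator a is a root of p - f q. If this polynomial vanished, a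
  -- nonzero coefficient of q would give f = pᵢ/qᵢ in k.
  refine ⟨p.map (algebraMap k L) - Polynomial.C ⟨f, hL⟩ * q.map (algebraMap k L),
    fun h0 ↦ hfk ?_, ?_⟩
  · obtain ⟨i, hi⟩ : ∃ i, q.coeff i ≠ 0 := by
      by_contra! h
      have hq0 : q = 0 := Polynomial.ext (by simpa using h)
      exact hq (by rw [hq0, map_zero])
    have h1 := congrArg (fun r ↦ algebraMap L K (r.coeff i)) h0
    simp only [Polynomial.coeff_sub, Polynomial.coeff_map, Polynomial.coeff_C_mul,
      Polynomial.coeff_zero, map_sub, map_mul, map_zero, ← IsScalarTower.algebraMap_apply,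
      sub_eq_zero] at h1
    have h2 : algebraMap k K (q.coeff i) ≠ 0 := by simpa using hi
    refine mem_bot.2 ⟨p.coeff i / q.coeff i, ?_⟩
    rw [map_div₀, h1]
    exact mul_div_cancel_right₀ _ h2
  · rw [map_sub, map_mul, Polynomial.aeval_C, Polynomial.aeval_map_algebraMap,
      Polynomial.aeval_map_algebraMap]
    exact sub_eq_zero.2 (div_mul_cancel₀ _ hq).symm

theorem finite_range_algHom_apply {F K : Type*} [Field F] [Field K] [Algebra F K] {a : K}
    (ha : IsAlgebraic F a) : (Set.range fun τ : K →ₐ[F] K ↦ τ a).Finite := by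
  refine ((minpoly F a).rootSet_finite K).subset ?_
  rintro _ ⟨τ, rfl⟩
  rw [Polynomial.mem_rootSet]
  refine ⟨minpoly.ne_zero ha.isIntegral, ?_⟩
  rw [Polynomial.aeval_algHom_apply, minpoly.aeval, map_zero]

theorem orbit_finite_of_bot_lt (hW : W.NonUnivariate)
    (h : (⊥ : IntermediateField W.k KK) < W.kx ⊓ W.ky) : W.orbit.Finite := by
  obtain ⟨f, hf, hfk⟩ := SetLike.exists_of_lt h
  have hx : IsAlgebraic ↥(W.kx ⊓ W.ky) x := isAlgebraic_of_mem_adjoin_simple hf.1 hfk hf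
  have hy : IsAlgebraic ↥(W.kx ⊓ W.ky) y := isAlgebraic_of_mem_adjoin_simple hf.2 hfk hf
  refine ((finite_range_algHom_apply hx).prod (finite_range_algHom_apply hy)).subset
    fun p hp ↦ ?_
  obtain ⟨σ, h1, h2, h3⟩ := exists_algEquiv_of_mem_orbit hW hp
  let τ : KK →ₐ[↥(W.kx ⊓ W.ky)] KK := { (σ : KK →+* KK) with commutes' := fun z ↦ h3 z z.2 }
  exact ⟨⟨τ, h1⟩, ⟨τ, h2⟩⟩

/-! ### The action of G on the orbit -/

theorem DefinedAt.map {u v : KK} (h : W.DefinedAt u v) (σ : KK →ₐ[ℂ] KK) :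
    W.DefinedAt (σ u) (σ v) := fun s hs ↦
  ⟨fun hu ↦ (h s hs).1 ((map_eq_zero σ).1 hu), fun hv ↦ (h s hs).2 ((map_eq_zero σ).1 hv)⟩

theorem SameValue.map {p q : KK × KK} (h : W.SameValue p q) (σ : KK →ₐ[ℂ] KK) :
    W.SameValue (Prod.map σ σ p) (Prod.map σ σ q) := by
  refine ⟨h.1.map σ, h.2.1.map σ, ?_⟩
  have := congrArg σ h.2.2
  rwa [map_S, map_S] at this

theorem Adjacent.map {p q : KK × KK} (h : W.Adjacent p q) (σ : KK →ₐ[ℂ] KK) :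
    W.Adjacent (Prod.map σ σ p) (Prod.map σ σ q) :=
  h.imp (fun h ↦ ⟨h.1.map σ, congrArg σ h.2⟩) (fun h ↦ ⟨h.1.map σ, congrArg σ h.2⟩)

theorem definedAt_xy : W.DefinedAt x y := fun _ _ ↦
  ⟨fun h ↦ absurd h x_ne_zero, fun h ↦ absurd h y_ne_zero⟩

theorem map_S_xy (σ : KK →ₐ[W.k] KK) : σ (W.S x y) = W.S x y :=
  σ.commutes ⟨W.S x y, mem_adjoin_simple_self ℂ _⟩

/-- A path from p to (x,y) is mapped to a path from σ(p) to (σ(x),σ(y)); the latter is adjacent to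
(x,y), as σ fixes S(x,y) and one coordinate. -/
theorem map_mem_orbit (σ : KK →ₐ[W.k] KK) (h : σ x = x ∨ σ y = y) {p : KK × KK}
    (hp : p ∈ W.orbit) : Prod.map σ σ p ∈ W.orbit := by
  let τ : KK →ₐ[ℂ] KK := σ.restrictScalars ℂ
  have hp' : Relation.TransGen W.Adjacent p (x, y) := hp
  refine Relation.TransGen.tail (hp'.lift (Prod.map τ τ) fun _ _ h ↦ h.map τ) ?_
  have hS : W.SameValue (Prod.map τ τ (x, y)) (x, y) :=
    ⟨definedAt_xy.map τ, definedAt_xy, (map_S τ x y).symm.trans (map_S_xy σ)⟩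
  exact h.imp (fun h ↦ ⟨hS, h⟩) (fun h ↦ ⟨hS, h⟩)

theorem map_mem_kO (σ : KK →ₐ[W.k] KK) (h : σ x = x ∨ σ y = y) {z : KK} (hz : z ∈ W.kO) :
    σ z ∈ W.kO := by
  have : W.kO ≤ W.kO.comap σ := by
    refine adjoin_le_iff.2 ?_
    rintro _ (⟨p, hp, rfl⟩ | ⟨p, hp, rfl⟩)
    · exact subset_adjoin _ _ (Or.inl ⟨_, map_mem_orbit σ h hp, rfl⟩)
    · exact subset_adjoin _ _ (Or.inr ⟨_, map_mem_orbit σ h hp, rfl⟩)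
  exact this hz

theorem fst_mem_kO {p : KK × KK} (hp : p ∈ W.orbit) : p.1 ∈ W.kO :=
  subset_adjoin _ _ (Or.inl ⟨p, hp, rfl⟩)

theorem snd_mem_kO {p : KK × KK} (hp : p ∈ W.orbit) : p.2 ∈ W.kO :=
  subset_adjoin _ _ (Or.inr ⟨p, hp, rfl⟩)

theorem isAlgebraic_kO (hW : W.NonUnivariate) : Algebra.IsAlgebraic W.kO KK where
  isAlgebraic z := by
    have := isAlgebraic_kx hW
    obtain ⟨p, hp, hz⟩ := Algebra.IsAlgebraic.isAlgebraic (R := W.kx) z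
    refine ⟨p.map (inclusion W.kx_le_kO).toRingHom, ?_, ?_⟩
    · rwa [Ne, Polynomial.map_eq_zero]
    · rw [Polynomial.aeval_def, Polynomial.eval₂_map]
      exact hz

theorem exists_extension (hW : W.NonUnivariate) (g : W.kO →ₐ[W.k] W.kO) :
    ∃ σ : KK →ₐ[W.k] KK, ∀ z : W.kO, σ z = g z := by
  have := isAlgebraic_kO hW
  obtain ⟨σ, hσ⟩ := IntermediateField.exists_algHom_of_splits' (E := KK) (W.kO.val.comp g)
    fun s ↦ ⟨(Algebra.IsAlgebraic.isAlgebraic s).isIntegral, IsAlgClosed.splits _⟩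
  exact ⟨σ, fun z ↦ DFunLike.congr_fun hσ z⟩

/-- The orbit, as a set of pairs of elements of `k(𝒪)`. -/
def orbitInKO (W : WeightedModel) : Set (W.kO × W.kO) := {p | ((p.1 : KK), (p.2 : KK)) ∈ W.orbit}

theorem map_mem_orbitInKO (hW : W.NonUnivariate) {g : W.kO ≃ₐ[W.k] W.kO} (hg : g ∈ W.Gx ∨ g ∈ W.Gy)
    {p : W.kO × W.kO} (hp : p ∈ W.orbitInKO) : Prod.map g g p ∈ W.orbitInKO := by
  obtain ⟨σ, hσ⟩ := exists_extension hW g.toAlgHom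
  have h : σ x = x ∨ σ y = y := by
    refine hg.imp (fun hg ↦ ?_) (fun hg ↦ ?_)
    · have hx : x ∈ W.kx := mem_adjoin_simple_self _ x
      have h1 := (mem_fixingSubgroup_iff _ _).1 hg ⟨x, W.kx_le_kO hx⟩ ((mem_restrict _ _).2 hx)
      exact (hσ ⟨x, W.kx_le_kO hx⟩).trans (congrArg Subtype.val h1)
    · have hy : y ∈ W.ky := mem_adjoin_simple_self _ y
      have h1 := (mem_fixingSubgroup_iff _ _).1 hg ⟨y, W.ky_le_kO hy⟩ ((mem_restrict _ _).2 hy)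
      exact (hσ ⟨y, W.ky_le_kO hy⟩).trans (congrArg Subtype.val h1)
  have := map_mem_orbit σ h hp
  simpa [orbitInKO, hσ] using this

theorem G_map_mem_orbitInKO (hW : W.NonUnivariate) {g : W.kO ≃ₐ[W.k] W.kO} (hg : g ∈ W.G)
    {p : W.kO × W.kO} (hp : p ∈ W.orbitInKO) : Prod.map g g p ∈ W.orbitInKO := by
  rw [G, Subgroup.sup_eq_closure] at hg
  induction hg using Subgroup.closure_induction'' generalizing p with
  | mem g hg => exact map_mem_orbitInKO hW hg hp
  | inv_mem g hg =>
    exact map_mem_orbitInKO hW (hg.imp (fun h ↦ inv_mem h) (fun h ↦ inv_mem h)) hp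
  | one => exact hp
  | mul g h _ _ hg hh => exact hg (hh hp)

theorem finite_G_of_orbit_finite (hW : W.NonUnivariate) (h : W.orbit.Finite) : Finite W.G := by
  have hfin : Finite W.orbitInKO := by
    have : Finite W.orbit := h
    refine Finite.of_injective (β := W.orbit) (fun p ↦ ⟨_, p.2⟩) fun p q hpq ↦ ?_
    exact Subtype.ext (Prod.ext (Subtype.ext (congrArg (fun r ↦ r.1.1) hpq))
      (Subtype.ext (congrArg (fun r ↦ r.1.2) hpq)))
  let φ : W.G → W.orbitInKO → W.orbitInKO := fun g p ↦ ⟨_, G_map_mem_orbitInKO hW g.2 p.2⟩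
  refine Finite.of_injective φ fun g h hgh ↦ Subtype.ext (AlgEquiv.coe_toAlgHom_injective ?_)
  refine algHom_ext_of_eq_adjoin (S := W.kO) W.k rfl ?_
  rintro _ (⟨p, hp, rfl⟩ | ⟨p, hp, rfl⟩)
  · have := congrFun hgh ⟨(⟨p.1, fst_mem_kO hp⟩, ⟨p.2, snd_mem_kO hp⟩), hp⟩
    exact congrArg (fun r ↦ r.1.1) this
  · have := congrFun hgh ⟨(⟨p.1, fst_mem_kO hp⟩, ⟨p.2, snd_mem_kO hp⟩), hp⟩
    exact congrArg (fun r ↦ r.1.2) this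

/-! ### The elements fixed by G -/

theorem exists_algEquiv_restrict {k K : Type*} [Field k] [Field K] [Algebra k K]
    (E : IntermediateField k K) (σ : K ≃ₐ[k] K) (h : ∀ z ∈ E, σ z ∈ E)
    (h' : ∀ z ∈ E, σ.symm z ∈ E) : ∃ g : E ≃ₐ[k] E, ∀ z : E, (g z : K) = σ z := by
  refine ⟨AlgEquiv.ofAlgHom
    ((σ.toAlgHom.comp E.val).codRestrict E.toSubalgebra fun z ↦ h z z.2)
    ((σ.symm.toAlgHom.comp E.val).codRestrict E.toSubalgebra fun z ↦ h' z z.2) ?_ ?_,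
    fun z ↦ rfl⟩
  · ext z
    exact σ.apply_symm_apply z
  · ext z
    exact σ.symm_apply_apply z

/-- In characteristic zero 𝕂 is Galois over F. Stability lets each element of Aut(𝕂|F) restrict to
E, so an element of E fixed by the automorphisms of E over F is fixed by all of Aut(𝕂|F). -/
theorem mem_of_fixed_of_stable {k K : Type*} [Field k] [CharZero k] [Field K] [Algebra k K]
    [IsAlgClosed K] {E F : IntermediateField k K} [Algebra.IsAlgebraic F K] (hFE : F ≤ E)
    (hE : ∀ σ : K ≃ₐ[k] K, (∀ z ∈ F, σ z = z) → ∀ z ∈ E, σ z ∈ E) {z : E}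
    (hz : ∀ g ∈ (restrict hFE).fixingSubgroup, g z = z) : (z : K) ∈ F := by
  have : IsAlgClosure F K := ⟨inferInstance, inferInstance⟩
  have : Normal F K := IsAlgClosure.normal F K
  have : CharZero F := charZero_of_injective_algebraMap (algebraMap k F).injective
  have : IsGalois F K := ⟨⟩
  have h : (z : K) ∈ (⊥ : IntermediateField F K) := by
    refine (InfiniteGalois.mem_bot_iff_fixed _).2 fun σ ↦ ?_
    have hσ : ∀ σ : K ≃ₐ[F] K, ∀ w ∈ F, σ w = w := fun σ w hw ↦ σ.commutes ⟨w, hw⟩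
    obtain ⟨g, hg⟩ := exists_algEquiv_restrict E (σ.restrictScalars k)
      (hE (σ.restrictScalars k) (hσ σ)) (hE (σ.symm.restrictScalars k) (hσ σ.symm))
    have hgF : g ∈ (restrict hFE).fixingSubgroup := (mem_fixingSubgroup_iff _ _).2 fun w hw ↦
      Subtype.ext ((hg w).trans (hσ σ w ((mem_restrict hFE w).1 hw)))
    exact (hg z).symm.trans (congrArg Subtype.val (hz g hgF))
  obtain ⟨w, hw⟩ := mem_bot.1 h
  exact hw ▸ w.2

theorem mem_inf_of_fixed (hW : W.NonUnivariate) {z : W.kO} (hz : ∀ g ∈ W.G, g z = z) :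
    (z : KK) ∈ W.kx ⊓ W.ky := by
  have := isAlgebraic_kx hW
  have := isAlgebraic_ky hW
  have : CharZero W.k := charZero_of_injective_algebraMap (algebraMap ℂ W.k).injective
  constructor
  · exact mem_of_fixed_of_stable W.kx_le_kO
      (fun σ hσ w ↦ map_mem_kO σ.toAlgHom (Or.inl (hσ x (mem_adjoin_simple_self _ x))))
      fun g hg ↦ hz g (Subgroup.mem_sup_left hg)
  · exact mem_of_fixed_of_stable W.ky_le_kO
      (fun σ hσ w ↦ map_mem_kO σ.toAlgHom (Or.inr (hσ y (mem_adjoin_simple_self _ y))))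
      fun g hg ↦ hz g (Subgroup.mem_sup_right hg)

theorem algebraicIndependent_S_x (hW : W.NonUnivariate) :
    AlgebraicIndependent ℂ ![W.S x y, x] :=
  algebraicIndependent_pair_iff.2 ⟨algebraicIndependent_xy.transcendental 0,
    transcendental_S hW.2 algebraicIndependent_xy.pair_swap⟩

theorem algebraicIndependent_S_y (hW : W.NonUnivariate) :
    AlgebraicIndependent ℂ ![W.S x y, y] :=
  algebraicIndependent_pair_iff.2 ⟨algebraicIndependent_xy.transcendental 1, by
    have := transcendental_S (W := W.swap) (swap_exists W hW.1) algebraicIndependent_xy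
    rwa [swap_S] at this⟩

theorem bot_lt_of_finite_G (hW : W.NonUnivariate) (h : Finite W.G) :
    (⊥ : IntermediateField W.k KK) < W.kx ⊓ W.ky := by
  rw [bot_lt_iff_ne_bot]
  intro hbot
  have hx : x ∈ W.kO := fst_mem_kO W.xy_mem_orbit
  have : Algebra.IsInvariant W.k W.kO W.G := ⟨fun z hz ↦ by
    have hz' := mem_inf_of_fixed hW fun g hg ↦ hz ⟨g, hg⟩
    rw [hbot] at hz'
    obtain ⟨a, ha⟩ := mem_bot.1 hz'
    exact ⟨a, Subtype.ext ha⟩⟩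
  -- For a finite group with invariants k, each z is a root of ∏(T - g z), which has coefficients in
  -- k.
  have := Algebra.IsInvariant.isIntegral W.k W.kO W.G
  have h1 : IsIntegral W.k (⟨x, hx⟩ : W.kO) := Algebra.IsIntegral.isIntegral _
  have h2 : IsAlgebraic W.k x := (h1.map W.kO.val).isAlgebraic
  exact (algebraicIndependent_pair_iff.1 (algebraicIndependent_S_x hW).pair_swap).2 h2

end WeightedModel
end QuadrantWalk

/-! ### Evaluation of fractions and Galois invariants -/

namespace QuadrantWalk
namespace WeightedModel

variable (W : WeightedModel)

/-- The point `(x, y, 1 / S(x, y))` at which fractions of `ℂ(X, Y, t)` are evaluated. -/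
def point : Fin 3 → KK := ![x, y, 1 / W.S x y]

variable {W}

theorem S_xy_ne_zero (hW : W.NonUnivariate) : W.S x y ≠ 0 :=
  (algebraicIndependent_S_x hW).ne_zero 0

theorem aeval_kernelPoly (hW : W.NonUnivariate) : MvPolynomial.aeval W.point W.kernelPoly = 0 := by
  have hS := S_xy_ne_zero hW
  have key : ∑ s ∈ W.steps, algebraMap ℂ KK (W.weight s) * x ^ ((W.shiftX : ℤ) + s.1).toNat *
      y ^ ((W.shiftY : ℤ) + s.2).toNat = x ^ W.shiftX * y ^ W.shiftY * W.S x y := by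
    rw [S, Finset.mul_sum]
    refine Finset.sum_congr rfl fun s hs ↦ ?_
    have h1 : 0 ≤ (W.shiftX : ℤ) + s.1 := by
      have := Finset.le_sup (f := fun s : ℤ × ℤ ↦ (-s.1).toNat) hs
      simp only [shiftX]
      omega
    have h2 : 0 ≤ (W.shiftY : ℤ) + s.2 := by
      have := Finset.le_sup (f := fun s : ℤ × ℤ ↦ (-s.2).toNat) hs
      simp only [shiftY]
      omega
    rw [← zpow_natCast, ← zpow_natCast y, Int.toNat_of_nonneg h1, Int.toNat_of_nonneg h2,
      zpow_add₀ x_ne_zero, zpow_add₀ y_ne_zero, zpow_natCast, zpow_natCast]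
    ring
  simp only [kernelPoly, map_sub, map_mul, map_pow, MvPolynomial.aeval_X, map_sum,
    MvPolynomial.aeval_C]
  change x ^ W.shiftX * y ^ W.shiftY - 1 / W.S x y * ∑ s ∈ W.steps,
    algebraMap ℂ KK (W.weight s) * x ^ ((W.shiftX : ℤ) + s.1).toNat *
      y ^ ((W.shiftY : ℤ) + s.2).toNat = 0
  rw [key]
  field_simp
  ring

/-- Any representation P/Q with Q nonzero at the point will do: the reduced denominator divides Q,
so it does not vanish there either, whereas every multiple of the kernel polynomial does. -/
theorem isRegular_and_evalXY_div (hW : W.NonUnivariate) {P Q : PolyXYt}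
    (hQ : MvPolynomial.aeval W.point Q ≠ 0) :
    W.IsRegular (algebraMap PolyXYt FracXYt P / algebraMap PolyXYt FracXYt Q) ∧
      W.evalXY (algebraMap PolyXYt FracXYt P / algebraMap PolyXYt FracXYt Q) =
        MvPolynomial.aeval W.point P / MvPolynomial.aeval W.point Q := by
  set H := algebraMap PolyXYt FracXYt P / algebraMap PolyXYt FracXYt Q with hH
  set N := IsFractionRing.num PolyXYt H with hN
  set D : PolyXYt := (IsFractionRing.den PolyXYt H : PolyXYt) with hD
  have hD0 : D ≠ 0 := nonZeroDivisors.coe_ne_zero _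
  have hQ0 : Q ≠ 0 := fun h ↦ hQ (by rw [h, map_zero])
  have hinj := IsFractionRing.injective PolyXYt FracXYt
  have hQ' : algebraMap PolyXYt FracXYt Q ≠ 0 := fun h ↦
    hQ0 (hinj (h.trans (map_zero _).symm))
  have hD' : algebraMap PolyXYt FracXYt D ≠ 0 := fun h ↦
    hD0 (hinj (h.trans (map_zero _).symm))
  have hND : N * Q = P * D := by
    apply hinj
    rw [map_mul, map_mul]
    have h1 : algebraMap PolyXYt FracXYt N / algebraMap PolyXYt FracXYt D = H := by
      rw [hN, hD, ← IsFractionRing.mk'_eq_div, IsFractionRing.mk'_num_den]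
    exact (div_eq_div_iff hD' hQ').1 h1
  have hdvd : D ∣ Q := (IsFractionRing.num_den_reduced PolyXYt H).symm.dvd_of_dvd_mul_left
    (hND ▸ dvd_mul_left D P)
  refine ⟨fun hK ↦ hQ ?_, ?_⟩
  · obtain ⟨R, hR⟩ := hK.trans hdvd
    rw [hR, map_mul, aeval_kernelPoly hW, zero_mul]
  · have hevD : MvPolynomial.aeval W.point D ≠ 0 := by
      obtain ⟨R, hR⟩ := hdvd
      intro h
      exact hQ (by rw [hR, map_mul, h, zero_mul])
    refine (div_eq_div_iff hevD hQ).2 ?_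
    change MvPolynomial.aeval W.point N * _ = _
    rw [← map_mul, ← map_mul, hND]

section Evaluation

variable {ι : Type} {j : ι → Fin 3}

theorem aeval_fracVar_comp (p : MvPolynomial ι ℂ) :
    MvPolynomial.aeval (fracVar ∘ j) p = algebraMap PolyXYt FracXYt (MvPolynomial.rename j p) := by
  rw [← MvPolynomial.aeval_rename]
  have h : MvPolynomial.aeval fracVar = IsScalarTower.toAlgHom ℂ PolyXYt FracXYt :=
    MvPolynomial.algHom_ext fun i ↦ by rw [MvPolynomial.aeval_X]; rfl
  rw [h]
  rfl

/-- The map `j` selects variables, so that ℂ(X,t), ℂ(Y,t) and ℂ(t) are treated together. -/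
theorem exists_eq_div_of_mem_adjoin_fracVar (hj : AlgebraicIndependent ℂ (W.point ∘ j))
    {H : FracXYt} (hH : H ∈ IntermediateField.adjoin ℂ (Set.range (fracVar ∘ j))) :
    ∃ p q : MvPolynomial ι ℂ, MvPolynomial.aeval (W.point ∘ j) q ≠ 0 ∧
      H = algebraMap PolyXYt FracXYt (MvPolynomial.rename j p) /
        algebraMap PolyXYt FracXYt (MvPolynomial.rename j q) := by
  obtain ⟨p, q, rfl⟩ := (mem_adjoin_range_iff ℂ _ _).1 hH
  rw [aeval_fracVar_comp, aeval_fracVar_comp]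
  -- Division by zero yields 0, which is rewritten as 0/1.
  by_cases hq : q = 0
  · exact ⟨0, 1, by simp, by simp [hq]⟩
  · exact ⟨p, q, (map_ne_zero_iff _ hj).2 hq, rfl⟩

theorem evalXY_rename_div (hW : W.NonUnivariate) (p : MvPolynomial ι ℂ) {q : MvPolynomial ι ℂ}
    (hq : MvPolynomial.aeval (W.point ∘ j) q ≠ 0) :
    W.evalXY (algebraMap PolyXYt FracXYt (MvPolynomial.rename j p) /
        algebraMap PolyXYt FracXYt (MvPolynomial.rename j q)) =
      MvPolynomial.aeval (W.point ∘ j) p / MvPolynomial.aeval (W.point ∘ j) q := by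
  rw [← MvPolynomial.aeval_rename] at hq
  rw [(isRegular_and_evalXY_div hW hq).2, MvPolynomial.aeval_rename, MvPolynomial.aeval_rename]

theorem evalXY_mem_adjoin (hW : W.NonUnivariate) (hj : AlgebraicIndependent ℂ (W.point ∘ j))
    {H : FracXYt} (hH : H ∈ IntermediateField.adjoin ℂ (Set.range (fracVar ∘ j))) :
    W.evalXY H ∈ IntermediateField.adjoin ℂ (Set.range (W.point ∘ j)) := by
  obtain ⟨p, q, hq, rfl⟩ := exists_eq_div_of_mem_adjoin_fracVar hj hH
  exact (mem_adjoin_range_iff ℂ _ _).2 ⟨p, q, evalXY_rename_div hW p hq⟩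

theorem exists_evalXY_eq (hW : W.NonUnivariate) {e : KK}
    (he : e ∈ IntermediateField.adjoin ℂ (Set.range (W.point ∘ j))) :
    ∃ H ∈ IntermediateField.adjoin ℂ (Set.range (fracVar ∘ j)), W.IsRegular H ∧ W.evalXY H = e := by
  obtain ⟨p, q, hq, rfl⟩ : ∃ p q : MvPolynomial ι ℂ, MvPolynomial.aeval (W.point ∘ j) q ≠ 0 ∧
      e = MvPolynomial.aeval (W.point ∘ j) p / MvPolynomial.aeval (W.point ∘ j) q := by
    obtain ⟨p, q, h⟩ := (mem_adjoin_range_iff ℂ _ _).1 he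
    by_cases hq : MvPolynomial.aeval (W.point ∘ j) q = 0
    · exact ⟨0, 1, by simp, by simp [h, hq]⟩
    · exact ⟨p, q, hq, h⟩
  refine ⟨_, (mem_adjoin_range_iff ℂ _ _).2 ⟨p, q, by rw [aeval_fracVar_comp, aeval_fracVar_comp]⟩,
    ?_, evalXY_rename_div hW p hq⟩
  rw [← MvPolynomial.aeval_rename] at hq
  exact (isRegular_and_evalXY_div hW hq).1

/-- By cross-multiplication, equal values give a polynomial relation between the selected
coordinates of the point; these being independent, the relation already holds between polynomials.
-/
theorem evalXY_injOn (hW : W.NonUnivariate) (hj : AlgebraicIndependent ℂ (W.point ∘ j)) :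
    Set.InjOn W.evalXY (IntermediateField.adjoin ℂ (Set.range (fracVar ∘ j))) := by
  intro H hH H' hH' h
  obtain ⟨p, q, hq, rfl⟩ := exists_eq_div_of_mem_adjoin_fracVar hj hH
  obtain ⟨p', q', hq', rfl⟩ := exists_eq_div_of_mem_adjoin_fracVar hj hH'
  rw [evalXY_rename_div hW p hq, evalXY_rename_div hW p' hq', div_eq_div_iff hq hq', ← map_mul,
    ← map_mul] at h
  have hne : ∀ {r : MvPolynomial ι ℂ}, MvPolynomial.aeval (W.point ∘ j) r ≠ 0 →
      algebraMap PolyXYt FracXYt (MvPolynomial.rename j r) ≠ 0 := fun {r} hr h0 ↦ by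
    rw [← MvPolynomial.aeval_rename] at hr
    exact hr (by rw [IsFractionRing.injective PolyXYt FracXYt (h0.trans (map_zero _).symm),
      map_zero])
  rw [div_eq_div_iff (hne hq) (hne hq'), ← map_mul, ← map_mul, ← map_mul, ← map_mul, hj h]

end Evaluation

theorem point_comp_zero_two : W.point ∘ ![0, 2] = ![x, 1 / W.S x y] := by
  ext i
  fin_cases i <;> rfl

theorem point_comp_one_two : W.point ∘ ![1, 2] = ![y, 1 / W.S x y] := by
  ext i
  fin_cases i <;> rfl

theorem point_comp_two : W.point ∘ ![2] = ![1 / W.S x y] := by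
  ext i
  fin_cases i
  rfl

theorem algebraicIndependent_pair_one_div {a s : KK} (h : AlgebraicIndependent ℂ ![s, a]) :
    AlgebraicIndependent ℂ ![a, 1 / s] := by
  obtain ⟨ha, hs⟩ := algebraicIndependent_pair_iff.1 h
  refine (algebraicIndependent_pair_iff.2 ⟨ha, ?_⟩).pair_swap
  rw [one_div]
  exact fun hs' ↦ hs (IsAlgebraic.inv_iff.1 hs')

theorem fracXt_eq : fracXt = IntermediateField.adjoin ℂ (Set.range (fracVar ∘ ![0, 2])) := by
  simp [fracXt, Set.range_comp, Matrix.range_cons, Set.image_insert_eq, Set.pair_comm]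

theorem fracYt_eq : fracYt = IntermediateField.adjoin ℂ (Set.range (fracVar ∘ ![1, 2])) := by
  simp [fracYt, Set.range_comp, Matrix.range_cons, Set.image_insert_eq, Set.pair_comm]

theorem fract_eq : fract = IntermediateField.adjoin ℂ (Set.range (fracVar ∘ ![2])) := by
  simp [fract, Set.range_comp]

theorem fract_le_fracXt : fract ≤ fracXt := adjoin.mono _ _ _ (by simp)

theorem fract_le_fracYt : fract ≤ fracYt := adjoin.mono _ _ _ (by simp)

theorem adjoin_range_pair_one_div (a s : KK) :
    IntermediateField.adjoin ℂ (Set.range ![a, 1 / s]) = IntermediateField.adjoin ℂ {s, a} := by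
  rw [Matrix.range_cons, Matrix.range_cons, Matrix.range_empty, Set.union_empty,
    Set.singleton_union]
  apply le_antisymm <;> rw [adjoin_le_iff]
  · rintro z (rfl | rfl)
    · exact subset_adjoin _ _ (by simp)
    · exact div_mem (one_mem _) (subset_adjoin _ _ (by simp))
  · rintro z (rfl | rfl)
    · have := inv_mem (subset_adjoin ℂ {a, 1 / z} (Set.mem_insert_of_mem _ rfl))
      simpa using this
    · exact subset_adjoin _ _ (by simp)

theorem adjoin_range_one_div (s : KK) :
    IntermediateField.adjoin ℂ (Set.range ![1 / s]) = IntermediateField.adjoin ℂ {s} := by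
  rw [Matrix.range_cons, Matrix.range_empty, Set.union_empty]
  apply le_antisymm <;> rw [adjoin_le_iff]
  · rintro z rfl
    exact div_mem (one_mem _) (subset_adjoin _ _ (by simp))
  · rintro z rfl
    have := inv_mem (subset_adjoin ℂ {1 / z} rfl)
    simpa using this

theorem mem_bot_iff_mem_k {z : KK} : z ∈ (⊥ : IntermediateField W.k KK) ↔ z ∈ W.k := by
  rw [mem_bot]
  exact ⟨fun ⟨w, hw⟩ ↦ hw ▸ w.2, fun h ↦ ⟨⟨z, h⟩, rfl⟩⟩

theorem exists_invariants_iff_bot_lt (hW : W.NonUnivariate) :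
    (∃ I J : FracXYt, W.IsGaloisInvariantPair I J ∧ ¬ IsConstantPair I J) ↔
      (⊥ : IntermediateField W.k KK) < W.kx ⊓ W.ky := by
  have hx : AlgebraicIndependent ℂ (W.point ∘ ![0, 2]) := by
    rw [point_comp_zero_two]
    exact algebraicIndependent_pair_one_div (algebraicIndependent_S_x hW)
  have hy : AlgebraicIndependent ℂ (W.point ∘ ![1, 2]) := by
    rw [point_comp_one_two]
    exact algebraicIndependent_pair_one_div (algebraicIndependent_S_y hW)
  have ht : AlgebraicIndependent ℂ (W.point ∘ ![2]) := by
    rw [point_comp_two, algebraicIndependent_iff_transcendental]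
    exact hx.transcendental 1
  have hkx : ∀ z, z ∈ W.kx ↔ z ∈ IntermediateField.adjoin ℂ (Set.range (W.point ∘ ![0, 2])) :=
    fun z ↦ by rw [point_comp_zero_two, adjoin_range_pair_one_div, mem_kx_iff]
  have hky : ∀ z, z ∈ W.ky ↔ z ∈ IntermediateField.adjoin ℂ (Set.range (W.point ∘ ![1, 2])) :=
    fun z ↦ by rw [point_comp_one_two, adjoin_range_pair_one_div, mem_ky_iff]
  have hk : ∀ z, z ∈ (⊥ : IntermediateField W.k KK) ↔
      z ∈ IntermediateField.adjoin ℂ (Set.range (W.point ∘ ![2])) :=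
    fun z ↦ by rw [point_comp_two, adjoin_range_one_div, mem_bot_iff_mem_k, k]
  constructor
  · rintro ⟨I, J, ⟨hI, hJ, -, -, hIJ⟩, hc⟩
    refine lt_of_le_of_ne bot_le fun hbot ↦ hc ?_
    have hmem : W.evalXY I ∈ W.kx ⊓ W.ky :=
      ⟨(hkx _).2 (evalXY_mem_adjoin hW hx (fracXt_eq ▸ hI)),
        hIJ ▸ (hky _).2 (evalXY_mem_adjoin hW hy (fracYt_eq ▸ hJ))⟩
    rw [← hbot] at hmem
    -- The common value lies in k, hence is the value of some F in ℂ(t); injectivity on ℂ(X,t) and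
    -- on ℂ(Y,t) forces I = F and J = F.
    obtain ⟨F, hF, -, hFI⟩ := exists_evalXY_eq hW ((hk _).1 hmem)
    rw [← fract_eq] at hF
    exact ⟨F, hF, evalXY_injOn hW hx (fracXt_eq ▸ hI) (fracXt_eq ▸ fract_le_fracXt hF) hFI.symm,
      evalXY_injOn hW hy (fracYt_eq ▸ hJ) (fracYt_eq ▸ fract_le_fracYt hF)
        (hIJ.symm.trans hFI.symm)⟩
  · intro h
    obtain ⟨f, hf, hfk⟩ := SetLike.exists_of_lt h
    obtain ⟨I, hI, hIr, hIf⟩ := exists_evalXY_eq hW ((hkx _).1 hf.1)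
    obtain ⟨J, hJ, hJr, hJf⟩ := exists_evalXY_eq hW ((hky _).1 hf.2)
    refine ⟨I, J, ⟨fracXt_eq ▸ hI, fracYt_eq ▸ hJ, hIr, hJr, hIf.trans hJf.symm⟩, ?_⟩
    rintro ⟨F, hF, rfl, -⟩
    exact hfk (hIf ▸ (hk _).2 (evalXY_mem_adjoin hW ht (fract_eq ▸ hF)))

end WeightedModel
end QuadrantWalk

end

theorem theorem4p3 (W : QuadrantWalk.WeightedModel) (hW : W.NonUnivariate) :
    List.TFAE [
      W.orbit.Finite,
      Finite W.G,
      ∃ I J : QuadrantWalk.FracXYt,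
        W.IsGaloisInvariantPair I J ∧ ¬ QuadrantWalk.IsConstantPair I J,
      (⊥ : IntermediateField W.k QuadrantWalk.KK) < W.kx ⊓ W.ky] := by
  tfae_have 1 → 2 := QuadrantWalk.WeightedModel.finite_G_of_orbit_finite hW
  tfae_have 2 → 4 := QuadrantWalk.WeightedModel.bot_lt_of_finite_G hW
  tfae_have 4 → 1 := QuadrantWalk.WeightedModel.orbit_finite_of_bot_lt hW
  tfae_have 3 ↔ 4 := QuadrantWalk.WeightedModel.exists_invariants_iff_bot_lt hW
  tfae_finish
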